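/- Let $n, d \ge 2$, and equip the $k$-th factor of $V=(\mathbb{R}^n)^{\otimes d}$, for $k=1,\dots,d$, with a nondegenerate symmetric bilinear form $\langle\cdot,\cdot\rangle_k$ on $\mathbb{R}^n$ (for instance the Euclidean inner product). Write $v\perp w$ in the $k$-th factor if $\langle v,w\rangle_k=0$. For $r\ge 0$ let $W_r\subseteq V$ be the Zariski closure of the set of all tensors $\sum_{i=1}^r x^{(i)}_1\otimes\cdots\otimes x^{(i)}_d$, with $x^{(i)}_k\in\mathbb{R}^n$, such that for all $i\ne j$ there are two indices $k_1\neq k_2$ with $x^{(i)}_{k_1}\perp x^{(j)}_{k_1}$ and $x^{(i)}_{k_2}\perp x^{(j)}_{k_2}$ (zero summands are allowed). Let the two-orthogonal variety $W\subseteq V$ be the Zariski closure of $\bigcup_r W_r$. Then $$\dim W \;\ge\; n^{d-1}+d\binom n2 ,$$ where $\dim W$ is the dimension of $W$ as a real algebraic set, i.e. the Krull dimension of its coordinate ring, the ring of real polynomials on $V$ modulo those that vanish on $W$. -/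

import Mathlib

open scoped TensorProduct

namespace TwoOrthogonal

/-- The tensor space `(ℝⁿ)^{⊗d}`. -/
abbrev TensorSpace (n d : ℕ) : Type :=
  ⨂[ℝ] _ : Fin d, (Fin n → ℝ)

/-- The basis `e_{i₁} ⊗ ⋯ ⊗ e_{i_d}` of `(ℝⁿ)^{⊗d}` built from the standard basis of `ℝⁿ`. -/
noncomputable def stdBasis (n d : ℕ) :
    Module.Basis (Fin d → Fin n) ℝ (TensorSpace n d) :=
  Basis.piTensorProduct fun _ => Pi.basisFun ℝ (Fin n)

/-- The entries `T_{i₁ … i_d}` of a tensor, a linear isomorphism from `(ℝⁿ)^{⊗d}` onto the affine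
space of dimension `n ^ d`. -/
noncomputable def entries (n d : ℕ) : TensorSpace n d ≃ₗ[ℝ] ((Fin d → Fin n) → ℝ) :=
  (stdBasis n d).equivFun

/-- The ideal of all polynomials, in the entries of a tensor, that vanish on `S`. -/
noncomputable def ideal {n d : ℕ} (S : Set (TensorSpace n d)) :
    Ideal (MvPolynomial (Fin d → Fin n) ℝ) :=
  MvPolynomial.vanishingIdeal ℝ (entries n d '' S)

/-- The Zariski closure of `S`: the common zero set of all polynomials vanishing on `S`. -/
def zariskiClosure {n d : ℕ} (S : Set (TensorSpace n d)) : Set (TensorSpace n d) :=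
  entries n d ⁻¹' MvPolynomial.zeroLocus ℝ (ideal S)

/-- The dimension of a real algebraic set: the Krull dimension of its coordinate ring, the ring of
real polynomials modulo those that vanish on the set. -/
noncomputable def dimension {n d : ℕ} (S : Set (TensorSpace n d)) : WithBot ℕ∞ :=
  ringKrullDim (MvPolynomial (Fin d → Fin n) ℝ ⧸ ideal S)

/-- `v₁ ⊗ ⋯ ⊗ v_d` and `w₁ ⊗ ⋯ ⊗ w_d` are orthogonal in at least two factors, where the `k`-th
factor carries the bilinear form `B k`. -/
def OrthogonalInTwoFactors {n d : ℕ} (B : Fin d → LinearMap.BilinForm ℝ (Fin n → ℝ))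
    (v w : Fin d → Fin n → ℝ) : Prop :=
  ∃ k₁ k₂ : Fin d, k₁ ≠ k₂ ∧ B k₁ (v k₁) (w k₁) = 0 ∧ B k₂ (v k₂) (w k₂) = 0

/-- The sums of `r` pairwise two-orthogonal summands `x i 1 ⊗ ⋯ ⊗ x i d`. Zero summands are
allowed, so these are the tensors with a two-orthogonal decomposition of length at most `r`. -/
def twoOrthogonalTensors {n d : ℕ} (B : Fin d → LinearMap.BilinForm ℝ (Fin n → ℝ)) (r : ℕ) :
    Set (TensorSpace n d) :=
  {T | ∃ x : Fin r → Fin d → Fin n → ℝ,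
    (∀ i j, i ≠ j → OrthogonalInTwoFactors B (x i) (x j)) ∧
      T = ∑ i, PiTensorProduct.tprod ℝ (x i)}

/-- The variety `W_r` of two-orthogonal tensors of length at most `r`. -/
def boundedVariety {n d : ℕ} (B : Fin d → LinearMap.BilinForm ℝ (Fin n → ℝ)) (r : ℕ) :
    Set (TensorSpace n d) :=
  zariskiClosure (twoOrthogonalTensors B r)

/-- The two-orthogonal variety `W`, the Zariski closure of the union of all `W_r`. -/
def variety {n d : ℕ} (B : Fin d → LinearMap.BilinForm ℝ (Fin n → ℝ)) :
    Set (TensorSpace n d) :=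
  zariskiClosure (⋃ r : ℕ, boundedVariety B r)

end TwoOrthogonal

namespace TwoOrthogonal

/-! The words in `(ℤ/n)^d` with coordinate sum zero number `n ^ (d - 1)`, and any two differ in at
least two places. Given an orthogonal basis in each factor, every combination of the basis tensors
indexed by these words therefore lies in `W`. The coefficients give `n ^ (d - 1)` parameters; moving
the bases by isometries gives `d * n.choose 2` more.

It remains to find a point where this parametrization has injective derivative
(`card_le_dimension_of_hasStrictFDerivAt` then bounds the dimension). At the identity isometries,
entries off the code see only the skew-symmetric directions, each through one codeword neighbour per
coordinate (`sum_sumZeroCode_neighbours`). The coefficients chosen in `exists_weights` make those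
equations force the skew part to vanish; the entries on the code then give the coefficient
directions. -/

/-! ### Krull dimension bounds from parametrizations. -/

theorem ringKrullDim_le_of_isIntegral_of_injective (R S : Type*) [CommRing R] [CommRing S]
    [Algebra R S] [Algebra.IsIntegral R S] (h : Function.Injective (algebraMap R S)) :
    ringKrullDim R ≤ ringKrullDim S := by
  refine iSup_le fun l => ?_
  obtain ⟨Q, -, hQ, hQl⟩ := Ideal.exists_ideal_over_prime_of_isIntegral
    (RelSeries.head l).asIdeal (⊥ : Ideal S) (by rw [Ideal.comap_bot_of_injective _ h]; exact bot_le)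
  have : Q.LiesOver (RelSeries.head l).asIdeal := ⟨hQl.symm⟩
  obtain ⟨L, hL, -⟩ := Ideal.exists_ltSeries_of_hasGoingUp l Q
  rw [← hL]
  exact Order.LTSeries.length_le_krullDim L

/-- The Krull dimension of a finitely generated algebra over a field is at least the number of its
algebraically independent elements. -/
theorem card_le_ringKrullDim_of_injective {K A ι : Type} [Field K] [CommRing A] [Algebra K A]
    [Algebra.FiniteType K A] [Fintype ι] (f : MvPolynomial ι K →ₐ[K] A)
    (hf : Function.Injective f) : (Fintype.card ι : WithBot ℕ∞) ≤ ringKrullDim A := by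
  -- A minimal prime contracting to zero reduces to a domain, where transcendence degrees can be
  -- compared after Noether normalization.
  obtain ⟨Q, hQ, hQf⟩ := Ideal.exists_comap_eq_of_mem_minimalPrimes_of_injective
    (f := f.toRingHom) hf ⊥ (by simp [IsDomain.minimalPrimes_eq_singleton_bot])
  have hinj : Function.Injective ((Ideal.Quotient.mkₐ K Q).comp f) := by
    rw [injective_iff_map_eq_zero]
    intro p hp
    have : p ∈ Ideal.comap f.toRingHom Q := by
      simpa [Ideal.Quotient.eq_zero_iff_mem] using hp
    rwa [hQf] at this
  refine le_trans ?_ (ringKrullDim_quotient_le Q)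
  obtain ⟨s, g, hg, hgint⟩ := exists_integral_inj_algHom_of_fg K (A ⧸ Q)
  have hs : Fintype.card ι ≤ s := by
    have h1 : Algebra.IsAlgebraic (Algebra.adjoin K (Set.range fun i => g (MvPolynomial.X i)))
        (A ⧸ Q) := by
      have hr : Algebra.adjoin K (Set.range fun i => g (MvPolynomial.X i)) = g.range := by
        rw [← Algebra.map_top, ← MvPolynomial.adjoin_range_X, AlgHom.map_adjoin, ← Set.range_comp]
        rfl
      rw [hr]
      refine ⟨fun x => IsIntegral.isAlgebraic ?_⟩
      obtain ⟨p, hp, hpx⟩ := hgint x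
      refine ⟨p.map g.rangeRestrict.toRingHom, hp.map _, ?_⟩
      rw [Polynomial.eval₂_map]
      exact hpx
    have h2 := Algebra.IsAlgebraic.trdeg_le_cardinalMk K
      (Set.range fun i => g (MvPolynomial.X i))
    have h3 := trdeg_le_of_injective _ hinj
    have h4 := (h3.trans h2).trans Cardinal.mk_range_le
    simpa using h4
  algebraize [g.toRingHom]
  refine le_trans ?_ (ringKrullDim_le_of_isIntegral_of_injective (MvPolynomial (Fin s) K) _ hg)
  rw [MvPolynomial.ringKrullDim_of_isNoetherianRing]
  simpa using hs

/-- A real polynomial that vanishes on a neighbourhood of a point is zero. -/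
theorem eq_zero_of_eventually_eval_eq_zero {P : Type} [Fintype P] (p : MvPolynomial P ℝ)
    (y : P → ℝ) (h : ∀ᶠ z in nhds y, MvPolynomial.eval z p = 0) : p = 0 := by
  obtain ⟨ε, hε, hball⟩ := Metric.eventually_nhds_iff_ball.mp h
  refine MvPolynomial.funext_set (fun i => Metric.ball (y i) ε)
    (fun i => ?_) fun z hz => ?_
  · rw [Real.ball_eq_Ioo]
    exact Set.Ioo_infinite (by linarith)
  · rw [map_zero]
    refine hball z ?_
    rw [ball_pi _ hε]
    exact hz

/-- A set parametrized by a map with injective derivative at some point has dimension at least the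
number of parameters. -/
theorem card_le_dimension_of_hasStrictFDerivAt {n d : ℕ} {P : Type} [Fintype P]
    {S : Set (TensorSpace n d)} (b : Module.Basis (Fin d → Fin n) ℝ (TensorSpace n d))
    (Φ : (P → ℝ) → TensorSpace n d) (hΦ : ∀ u, Φ u ∈ S)
    (Φ' : (P → ℝ) →L[ℝ] ((Fin d → Fin n) → ℝ)) (u : P → ℝ)
    (hderiv : HasStrictFDerivAt (fun u => b.equivFun (Φ u)) Φ' u)
    (hinj : Function.Injective Φ') : (Fintype.card P : WithBot ℕ∞) ≤ dimension S := by
  classical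
  -- After the linear projection `π` the parametrization is a local surjection, so the projection of
  -- `S` contains an open set. No nonzero polynomial vanishes there, so the polynomial ring on `P`
  -- embeds in the coordinate ring of `S`.
  obtain ⟨π, hπ⟩ := LinearMap.exists_leftInverse_of_injective Φ'.toLinearMap
    (LinearMap.ker_eq_bot.mpr hinj)
  let N : ((Fin d → Fin n) → ℝ) →ₗ[ℝ] (P → ℝ) :=
    π ∘ₗ b.equivFun.toLinearMap ∘ₗ (entries n d).symm.toLinearMap
  have hN : ∀ T, N (entries n d T) = π (b.equivFun T) := fun T => by simp [N]
  let F : MvPolynomial P ℝ →ₐ[ℝ] MvPolynomial (Fin d → Fin n) ℝ :=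
    MvPolynomial.aeval fun i => ∑ j, MvPolynomial.C (LinearMap.toMatrix' N i j) * MvPolynomial.X j
  have hF : ∀ p x, MvPolynomial.eval x (F p) = MvPolynomial.eval (N x) p := by
    intro p x
    have : (MvPolynomial.aeval x).comp F = MvPolynomial.aeval (N x) := by
      refine MvPolynomial.algHom_ext fun i => ?_
      simp only [F, AlgHom.comp_apply, MvPolynomial.aeval_X, map_sum, map_mul,
        MvPolynomial.aeval_C, Algebra.algebraMap_self, RingHom.id_apply]
      rw [← LinearMap.toMatrix'_mulVec N x]
      rfl
    simpa [MvPolynomial.aeval_eq_eval] using DFunLike.congr_fun this p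
  have hmap : Filter.map (fun u => π (b.equivFun (Φ u))) (nhds u) =
      nhds (π (b.equivFun (Φ u))) := by
    have h1 := (LinearMap.toContinuousLinearMap π).hasStrictFDerivAt.comp u hderiv
    refine h1.map_nhds_eq_of_surj (LinearMap.range_eq_top.mpr fun v => ⟨v, ?_⟩)
    exact LinearMap.congr_fun hπ v
  refine card_le_ringKrullDim_of_injective ((Ideal.Quotient.mkₐ ℝ (ideal S)).comp F) ?_
  rw [injective_iff_map_eq_zero]
  intro p hp
  have hmem : F p ∈ ideal S := by
    simpa [Ideal.Quotient.eq_zero_iff_mem] using hp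
  refine eq_zero_of_eventually_eval_eq_zero p (π (b.equivFun (Φ u))) ?_
  rw [← hmap, Filter.eventually_map]
  refine Filter.Eventually.of_forall fun v => ?_
  have := hmem (entries n d (Φ v)) ⟨_, hΦ v, rfl⟩
  rw [← hN, ← hF]
  simpa [MvPolynomial.aeval_eq_eval] using this

theorem twoOrthogonalTensors_subset_variety {n d : ℕ}
    (B : Fin d → LinearMap.BilinForm ℝ (Fin n → ℝ)) (r : ℕ) :
    twoOrthogonalTensors B r ⊆ variety B := by
  have h : ∀ S : Set (TensorSpace n d), S ⊆ zariskiClosure S :=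
    fun S T hT p hp => hp _ ⟨T, hT, rfl⟩
  exact (h _).trans ((Set.subset_iUnion (boundedVariety B) r).trans (h _))

/-! ### Isometry groups of diagonal forms. -/

/-- The `(p, q)` entry of the skew-symmetric matrix with given entries above the diagonal. -/
noncomputable def skewEntry {n : ℕ} (p q : Fin n) :
    ({i : Fin n × Fin n // i.1 < i.2} → ℝ) →L[ℝ] ℝ :=
  if h : p < q then ContinuousLinearMap.proj ⟨(p, q), h⟩
  else if h : q < p then -ContinuousLinearMap.proj ⟨(q, p), h⟩ else 0

theorem skewEntry_swap {n : ℕ} (p q : Fin n) (u : {i : Fin n × Fin n // i.1 < i.2} → ℝ) :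
    skewEntry q p u = -skewEntry p q u := by
  rcases lt_trichotomy p q with h | rfl | h
  · simp [skewEntry, h, h.not_gt]
  · simp [skewEntry]
  · simp [skewEntry, h, h.not_gt]

theorem eq_zero_of_skewEntry_eq_zero {n : ℕ} (u : {i : Fin n × Fin n // i.1 < i.2} → ℝ)
    (h : ∀ p q, p ≠ q → skewEntry p q u = 0) : u = 0 := by
  funext ⟨⟨p, q⟩, hpq⟩
  have hpq' : p < q := hpq
  simpa [skewEntry, hpq'] using h p q hpq'.ne

open scoped Matrix.Norms.Operator in
/-- Near the identity, the isometry group of a nondegenerate diagonal form is parametrized by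
skew-symmetric matrices. -/
theorem exists_isometry_parametrization {n : ℕ} (e : Fin n → ℝ) (he : ∀ i, e i ≠ 0) :
    ∃ γ : ({i : Fin n × Fin n // i.1 < i.2} → ℝ) → Matrix (Fin n) (Fin n) ℝ,
      γ 0 = 1 ∧ (∀ u, (γ u).transpose * Matrix.diagonal e * γ u = Matrix.diagonal e) ∧
      ∀ p q, HasStrictFDerivAt (fun u => γ u p q) ((e p)⁻¹ • skewEntry p q) 0 := by
  let Y : ({i : Fin n × Fin n // i.1 < i.2} → ℝ) →ₗ[ℝ] Matrix (Fin n) (Fin n) ℝ :=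
    { toFun := fun u => Matrix.of fun p q => (e p)⁻¹ * skewEntry p q u
      map_add' := fun u v => by ext; simp [mul_add]
      map_smul' := fun c u => by ext; simp; ring }
  have hunit : IsUnit (Matrix.diagonal e) := by
    rw [Matrix.isUnit_diagonal, Pi.isUnit_iff]
    exact fun i => (he i).isUnit
  -- With `D = diagonal e`, this conjugation gives `exp(Y)ᵀ = D exp(-Y) D⁻¹`, hence `exp(Y)ᵀ D
  -- exp(Y) = D`.
  have hskew : ∀ u, (Y u).transpose = Matrix.diagonal e * -Y u * (Matrix.diagonal e)⁻¹ := by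
    intro u
    have h : (Y u).transpose * Matrix.diagonal e = Matrix.diagonal e * -Y u := by
      ext p q
      simp only [Matrix.mul_diagonal, Matrix.diagonal_mul, Matrix.transpose_apply,
        Matrix.neg_apply]
      simp only [Y, LinearMap.coe_mk, AddHom.coe_mk, Matrix.of_apply]
      rw [skewEntry_swap p q]
      field_simp [he p, he q]
    rw [← h, Matrix.mul_nonsing_inv_cancel_right _ _ ((Matrix.isUnit_iff_isUnit_det _).mp hunit)]
  refine ⟨fun u => NormedSpace.exp (Y u), by simp, fun u => ?_, fun p q => ?_⟩
  · have hdet := (Matrix.isUnit_iff_isUnit_det _).mp hunit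
    have hdet' := (Matrix.isUnit_iff_isUnit_det _).mp (Matrix.isUnit_exp (Y u))
    rw [← Matrix.exp_transpose, hskew, Matrix.exp_conj _ _ hunit, Matrix.exp_neg,
      Matrix.nonsing_inv_mul_cancel_right _ _ hdet, Matrix.nonsing_inv_mul_cancel_right _ _ hdet']
  · have h1 : HasStrictFDerivAt (fun u => NormedSpace.exp (Y u))
        ((1 : Matrix (Fin n) (Fin n) ℝ →L[ℝ] Matrix (Fin n) (Fin n) ℝ).comp
          (LinearMap.toContinuousLinearMap Y)) 0 := by
      refine HasStrictFDerivAt.comp (g := NormedSpace.exp) (f := fun u => Y u) 0 ?_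
        (LinearMap.toContinuousLinearMap Y).hasStrictFDerivAt
      rw [map_zero]
      exact hasStrictFDerivAt_exp_zero
    have h2 := ((LinearMap.toContinuousLinearMap
      (Matrix.entryLinearMap ℝ ℝ p q)).hasStrictFDerivAt).comp 0 h1
    refine h2.congr_fderiv ?_
    ext u
    rfl

/-! ### The sum-zero code. -/

/-- The sum-zero code in `(ℤ/n)^d`. -/
def sumZeroCode (n d : ℕ) [NeZero n] : Finset (Fin d → Fin n) :=
  Finset.univ.filter fun j => ∑ k, j k = 0

theorem mem_sumZeroCode {n d : ℕ} [NeZero n] {j : Fin d → Fin n} :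
    j ∈ sumZeroCode n d ↔ ∑ k, j k = 0 := by
  simp [sumZeroCode]

theorem card_sumZeroCode (n d : ℕ) [NeZero n] : (sumZeroCode n (d + 1)).card = n ^ d := by
  have : (Finset.univ : Finset (Fin d → Fin n)).card = n ^ d := by simp
  rw [← this]
  refine Finset.card_bij' (fun j _ => Fin.tail j) (fun t _ => Fin.cons (-∑ k, t k) t) ?_ ?_ ?_ ?_
  · simp
  · intro t _
    simp [mem_sumZeroCode, Fin.sum_univ_succ]
  · intro j hj
    rw [mem_sumZeroCode, Fin.sum_univ_succ] at hj
    have h : -∑ k, Fin.tail j k = j 0 := neg_eq_of_add_eq_zero_left hj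
    rw [h, Fin.cons_self_tail]
  · simp

/-- Any one coordinate of a codeword is determined by the others. -/
theorem exists_ne_ne_of_mem_sumZeroCode {n d : ℕ} [NeZero n] {i j : Fin d → Fin n}
    (hi : i ∈ sumZeroCode n d) (hj : j ∈ sumZeroCode n d) (hij : i ≠ j) :
    ∃ k₁ k₂, k₁ ≠ k₂ ∧ i k₁ ≠ j k₁ ∧ i k₂ ≠ j k₂ := by
  obtain ⟨k, hk⟩ := Function.ne_iff.mp hij
  by_contra! h
  rw [mem_sumZeroCode] at hi hj
  refine hk ?_
  have h2 : ∀ l ∈ Finset.univ.erase k, i l = j l := fun l hl =>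
    h k l (Finset.ne_of_mem_erase hl).symm hk
  rw [← Finset.add_sum_erase _ _ (Finset.mem_univ k)] at hi hj
  rw [Finset.sum_congr rfl h2, ← hj] at hi
  exact add_right_cancel hi

theorem sum_update {n d : ℕ} [NeZero n] (j : Fin d → Fin n) (k : Fin d) (q : Fin n) :
    ∑ l, Function.update j k q l = ∑ l, j l - j k + q := by
  rw [Finset.sum_update_of_mem (Finset.mem_univ k), Finset.sdiff_singleton_eq_erase,
    ← Finset.add_sum_erase _ j (Finset.mem_univ k)]
  abel

/-- Each tuple has exactly one neighbour in the sum-zero code in each coordinate direction. -/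
theorem sum_sumZeroCode_neighbours {n d : ℕ} [NeZero n] (A : (Fin d → Fin n) → ℝ)
    (F : Fin d → Fin n → ℝ) (j : Fin d → Fin n) :
    ∑ c ∈ sumZeroCode n d, A c * ∑ k, (∏ l ∈ Finset.univ.erase k, if j l = c l then 1 else 0) *
      F k (c k) = ∑ k, A (Function.update j k (j k - ∑ l, j l)) * F k (j k - ∑ l, j l) := by
  simp_rw [Finset.mul_sum]
  rw [Finset.sum_comm]
  refine Finset.sum_congr rfl fun k _ => ?_
  rw [Finset.sum_eq_single (Function.update j k (j k - ∑ l, j l))]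
  · rw [Finset.prod_eq_one]
    · simp
    · intro l hl
      simp [Function.update_of_ne (Finset.ne_of_mem_erase hl)]
  · intro c hc hne
    have : ∃ l ∈ Finset.univ.erase k, j l ≠ c l := by
      by_contra! h
      refine hne ?_
      have hcj : c = Function.update j k (c k) := by
        funext l
        by_cases hl : l = k
        · subst hl; simp
        · rw [Function.update_of_ne hl, h l (by simp [hl])]
      rw [mem_sumZeroCode, hcj, sum_update] at hc
      rw [hcj]
      congr 1
      rw [eq_neg_of_add_eq_zero_right hc, neg_sub]
    obtain ⟨l, hl, hlne⟩ := this
    rw [Finset.prod_eq_zero hl (by simp [hlne])]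
    simp
  · intro h
    exact absurd (mem_sumZeroCode.mpr (by rw [sum_update]; abel)) h

/-! ### Coefficients with injective skew-symmetric action. -/

/-- Sum-zero codewords, all but one of which pairwise differ in every coordinate. -/
theorem exists_pairwise_disjoint_codewords (n : ℕ) [NeZero n] (d : ℕ) :
    ∃ w : Fin (d + 2) → Fin n → Fin n, (∀ u, ∑ k, w k u = 0) ∧
      ∀ k u v, u ≠ 0 → v ≠ 0 → w k u = w k v → u = v := by
  induction d using Nat.twoStepInduction with
  | zero =>
    refine ⟨![fun u => u, fun u => -u], fun u => by simp [Fin.sum_univ_two], fun k => ?_⟩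
    fin_cases k <;> simp
  | one =>
    -- Odd and even `u` fill disjoint ranges of residues, arranged so that `x u + y u` is `u - 1`
    -- modulo `n`. One word must be exempt: for even `n` the residues sum to `n / 2`, so three
    -- permutations cannot sum to zero pointwise.
    obtain ⟨x, hx⟩ : ∃ x : Fin n → ℕ, ∀ u, x u = if (u : ℕ) % 2 = 1 then ((u : ℕ) - 1) / 2 else
      ((u : ℕ) - 1) / 2 + (n + 1) / 2 := ⟨_, fun _ => rfl⟩
    obtain ⟨y, hy⟩ : ∃ y : Fin n → ℕ, ∀ u, y u = if (u : ℕ) % 2 = 1 then ((u : ℕ) - 1) / 2 else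
      (u : ℕ) / 2 + n / 2 := ⟨_, fun _ => rfl⟩
    have hxy : ∀ u : Fin n, u ≠ 0 → Fin.ofNat n (x u) + Fin.ofNat n (y u) = u - 1 := by
      intro u hu
      have hu' : (u : ℕ) ≠ 0 := fun h => hu (Fin.ext h)
      have := u.2
      rw [eq_sub_iff_add_eq]
      have hsum : x u + y u + 1 = u ∨ x u + y u + 1 = u + n := by
        rw [hx, hy]
        split_ifs <;> omega
      apply Fin.ext
      have hval : (Fin.ofNat n (x u) + Fin.ofNat n (y u) + 1).val = (x u + y u + 1) % n := by
        simp [Fin.val_add]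
      rw [hval]
      rcases hsum with h | h <;> rw [h]
      · exact Nat.mod_eq_of_lt u.2
      · rw [Nat.add_mod_right, Nat.mod_eq_of_lt u.2]
    refine ⟨![fun u => Fin.ofNat n (x u), fun u => Fin.ofNat n (y u),
      fun u => -(Fin.ofNat n (x u) + Fin.ofNat n (y u))], fun u => by simp [Fin.sum_univ_three],
      fun k u v hu hv h => ?_⟩
    have hu' : (u : ℕ) ≠ 0 := fun h => hu (Fin.ext h)
    have hv' : (v : ℕ) ≠ 0 := fun h => hv (Fin.ext h)
    have hun := u.2
    have hvn := v.2
    fin_cases k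
    · have h1 := congrArg Fin.val h
      simp only [Fin.zero_eta, Matrix.cons_val_zero, Fin.val_ofNat] at h1
      rw [Nat.mod_eq_of_lt (by rw [hx]; split_ifs <;> omega),
        Nat.mod_eq_of_lt (by rw [hx]; split_ifs <;> omega), hx, hx] at h1
      apply Fin.ext
      split_ifs at h1 <;> omega
    · have h1 := congrArg Fin.val h
      simp only [Fin.mk_one, Matrix.cons_val_one, Matrix.cons_val_zero, Fin.val_ofNat] at h1
      rw [Nat.mod_eq_of_lt (by rw [hy]; split_ifs <;> omega),
        Nat.mod_eq_of_lt (by rw [hy]; split_ifs <;> omega), hy, hy] at h1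
      apply Fin.ext
      split_ifs at h1 <;> omega
    · have h1 : -(Fin.ofNat n (x u) + Fin.ofNat n (y u)) =
        -(Fin.ofNat n (x v) + Fin.ofNat n (y v)) := h
      rw [hxy u hu, hxy v hv] at h1
      simpa using h1
  | more d ih _ =>
    obtain ⟨w, hw, hinj⟩ := ih
    -- Two further coordinates `u` and `-u` preserve the zero sum.
    refine ⟨Fin.cons (fun u => u) (Fin.cons (fun u => -u) w), fun u => ?_, fun k => ?_⟩
    · rw [Fin.sum_univ_succ, Fin.sum_univ_succ]
      simp [hw]
    · refine Fin.cases ?_ (fun k => Fin.cases ?_ (fun k => ?_) k) k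
      · simp
      · simp
      · simpa using hinj k

/-- There is a tensor supported on the sum-zero code on which the skew-symmetric matrices act
injectively. -/
theorem exists_weights {n d : ℕ} [NeZero n] (hd : 2 ≤ d) (e : Fin d → Fin n → ℝ)
    (he : ∀ k p, e k p = 1 ∨ e k p = -1) :
    ∃ A : (Fin d → Fin n) → ℝ, ∀ u : Fin d → {i : Fin n × Fin n // i.1 < i.2} → ℝ,
      (∀ j : Fin d → Fin n, ∑ k, j k ≠ 0 →
        ∑ k, A (Function.update j k (j k - ∑ l, j l)) *
          (e k (j k) * skewEntry (j k) (j k - ∑ l, j l) (u k)) = 0) → u = 0 := by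
  have he0 : ∀ k p, e k p ≠ 0 := fun k p => by rcases he k p with h | h <;> simp [h]
  obtain rfl | ⟨d, rfl⟩ : d = 2 ∨ ∃ d', d = d' + 3 := by
    rcases Nat.lt_or_ge 2 d with h | h
    · exact .inr ⟨d - 3, by omega⟩
    · exact .inl (le_antisymm h hd)
  -- Only values on the code `(p, -p)` matter. The equations for `(p, q)` and `(q, p)` form a 2×2
  -- system with determinant `±(p² ± q²)`, nonzero because the weights are distinct naturals.
  · refine ⟨fun j => ((j 0 : ℕ) : ℝ), fun u h => ?_⟩
    have heq : ∀ p q : Fin n, p ≠ q → (q : ℝ) * (e 0 p * skewEntry p q (u 0)) +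
        (p : ℝ) * (e 1 (-q) * skewEntry (-q) (-p) (u 1)) = 0 := by
      intro p q hpq
      have hs : -q - (p - q) = -p := by abel
      have := h ![p, -q] (by simpa [Fin.sum_univ_two, ← sub_eq_add_neg, sub_eq_zero] using hpq)
      simpa [Fin.sum_univ_two, ← sub_eq_add_neg, hs] using this
    have hzero : ∀ p q : Fin n, p ≠ q →
        skewEntry p q (u 0) = 0 ∧ skewEntry (-q) (-p) (u 1) = 0 := by
      intro p q hpq
      have h1 := heq p q hpq
      have h2 := heq q p hpq.symm
      rw [skewEntry_swap p q, skewEntry_swap (-q) (-p)] at h2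
      have hlt : (p : ℝ) ^ 2 - (q : ℝ) ^ 2 ≠ 0 := by
        rw [sub_ne_zero]
        intro h
        have h3 : (p : ℝ) = q := by
          rwa [sq_eq_sq₀ (Nat.cast_nonneg _) (Nat.cast_nonneg _)] at h
        exact hpq (Fin.ext (by exact_mod_cast h3))
      have hle : (p : ℝ) ^ 2 + (q : ℝ) ^ 2 ≠ 0 := by
        intro h
        have h3 : (p : ℝ) ^ 2 = 0 := by nlinarith [sq_nonneg (p : ℝ), sq_nonneg (q : ℝ)]
        have h4 : (q : ℝ) ^ 2 = 0 := by nlinarith [sq_nonneg (p : ℝ), sq_nonneg (q : ℝ)]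
        exact hlt (by rw [h3, h4, sub_zero])
      generalize skewEntry p q (u 0) = x at *
      generalize skewEntry (-q) (-p) (u 1) = y at *
      have hx : ((p : ℝ) ^ 2 - (q : ℝ) ^ 2) * x = 0 ∨ ((p : ℝ) ^ 2 + (q : ℝ) ^ 2) * x = 0 := by
        rcases he 0 p with a | a <;> rcases he 0 q with b | b <;> rcases he 1 (-p) with c | c <;>
          rcases he 1 (-q) with f | f <;> rw [a, f] at h1 <;> rw [b, c] at h2 <;>
          first
          | left; linear_combination (p : ℝ) * h2 + (q : ℝ) * h1
          | left; linear_combination (p : ℝ) * h2 - (q : ℝ) * h1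
          | left; linear_combination -(p : ℝ) * h2 + (q : ℝ) * h1
          | left; linear_combination -(p : ℝ) * h2 - (q : ℝ) * h1
          | right; linear_combination (p : ℝ) * h2 + (q : ℝ) * h1
          | right; linear_combination (p : ℝ) * h2 - (q : ℝ) * h1
          | right; linear_combination -(p : ℝ) * h2 + (q : ℝ) * h1
          | right; linear_combination -(p : ℝ) * h2 - (q : ℝ) * h1
      have hx0 : x = 0 := by
        rcases hx with h | h
        · exact (mul_eq_zero.mp h).resolve_left hlt
        · exact (mul_eq_zero.mp h).resolve_left hle
      subst hx0
      refine ⟨rfl, ?_⟩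
      simp only [mul_zero, zero_add, neg_zero, mul_eq_zero, he0, false_or, neg_eq_zero] at h1 h2
      rcases h1 with h1 | h1
      · rcases h2 with h2 | h2
        · exact absurd (by rw [h1, h2, sub_self]) hlt
        · exact h2
      · exact h1
    funext k
    refine eq_zero_of_skewEntry_eq_zero _ ?_
    fin_cases k
    · exact fun p q hpq => (hzero p q hpq).1
    · intro p q hpq
      simpa using (hzero (-q) (-p) (by simpa using hpq.symm)).2
  · obtain ⟨w, hw, hinj⟩ := exists_pairwise_disjoint_codewords n (d + 1)
    classical
    -- The chosen words are at mutual distance at least three, so a tuple at distance one from one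
    -- of them has no other chosen neighbour, and its equation has a single term.
    let A : (Fin (d + 3) → Fin n) → ℝ := fun j => if ∃ v, v ≠ 0 ∧ (fun k => w k v) = j then 1 else 0
    refine ⟨A, fun u h => ?_⟩
    have hmain : ∀ k v p, v ≠ 0 → p ≠ w k v → skewEntry p (w k v) (u k) = 0 := by
      intro k v p hv hp
      let j := Function.update (fun k => w k v) k p
      have hs : ∑ l, j l = p - w k v := by
        simp only [j]
        rw [sum_update, hw]
        abel
      have hj := h j (by rw [hs, sub_ne_zero]; exact hp)
      rw [Finset.sum_eq_single k, hs] at hj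
      · have hjk : j k - (p - w k v) = w k v := by simp [j]
        have hA : A (Function.update j k (w k v)) = 1 := by
          simp only [A]
          rw [if_pos]
          refine ⟨v, hv, ?_⟩
          simp [j]
        rw [hjk, hA, one_mul] at hj
        simpa [j, he0] using hj
      · intro k' _ hk'
        refine mul_eq_zero_of_left (if_neg ?_) _
        rintro ⟨v', hv', hvj⟩
        obtain ⟨l, hl, hl'⟩ : ∃ l : Fin (d + 3), l ≠ k ∧ l ≠ k' := by
          have : ((Finset.univ.erase k).erase k').Nonempty := by
            rw [← Finset.card_pos, Finset.card_erase_of_mem (by simp [hk']),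
              Finset.card_erase_of_mem (by simp)]
            simp
          obtain ⟨l, hl⟩ := this
          simp only [Finset.mem_erase, Finset.mem_univ, and_true] at hl
          exact ⟨l, hl.2, hl.1⟩
        have h1 := congrFun hvj l
        rw [Function.update_of_ne hl'] at h1
        simp only [j] at h1
        rw [Function.update_of_ne hl] at h1
        have h2 := hinj l v' v hv' hv h1
        have h3 := congrFun hvj k
        rw [Function.update_of_ne hk'.symm] at h3
        simp only [j, Function.update_self, h2] at h3
        exact hp h3.symm
      · simp
    funext k
    refine eq_zero_of_skewEntry_eq_zero _ fun p q hpq => ?_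
    -- The `n - 1` nonzero `v` take distinct values under `w k`, so at most one value is missed.
    have hcover : ∃ v, v ≠ 0 ∧ (w k v = p ∨ w k v = q) := by
      by_contra! hno
      have hmaps : (Finset.univ.erase (0 : Fin n)).image (w k) ⊆ (Finset.univ.erase p).erase q := by
        intro x hx
        obtain ⟨v, hv, rfl⟩ := Finset.mem_image.mp hx
        have hv0 := Finset.ne_of_mem_erase hv
        simp [hno v hv0]
      have hcard := Finset.card_le_card hmaps
      rw [Finset.card_image_of_injOn, Finset.card_erase_of_mem (by simp),
        Finset.card_erase_of_mem (by simp [hpq.symm]), Finset.card_erase_of_mem (by simp)] at hcard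
      · have hn2 : 2 ≤ n := by
          have := p.2
          have := q.2
          have : (p : ℕ) ≠ q := fun h => hpq (Fin.ext h)
          omega
        simp at hcard
        omega
      · intro a ha b hb hab
        exact hinj k a b (by simpa using ha) (by simpa using hb) hab
    obtain ⟨v, hv, rfl | rfl⟩ := hcover
    · rw [skewEntry_swap q, hmain k v q hv hpq.symm, neg_zero]
    · exact hmain k v p hv hpq

/-! ### Orthonormal bases and the parametrization of `W`. -/

/-- Rescaling an orthogonal basis leaves only signs; the determinant in the two-factor case of
`exists_weights` relies on this. -/
theorem exists_orthonormal_basis {n : ℕ} (B : LinearMap.BilinForm ℝ (Fin n → ℝ)) (hB : B.IsSymm)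
    (hB' : B.Nondegenerate) :
    ∃ (f : Module.Basis (Fin n) ℝ (Fin n → ℝ)) (e : Fin n → ℝ), (∀ i, e i = 1 ∨ e i = -1) ∧
      ∀ i j, B (f i) (f j) = Matrix.diagonal e i j := by
  have : Invertible (2 : ℝ) := invertibleOfNonzero two_ne_zero
  obtain ⟨g, hg⟩ := LinearMap.BilinForm.exists_orthogonal_basis (B := B)
    ⟨fun x y => by simpa using hB.eq x y⟩
  have hn : Module.finrank ℝ (Fin n → ℝ) = n := by simp
  have hself : ∀ i, B (g i) (g i) ≠ 0 := fun i =>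
    hg.not_isOrtho_basis_self_of_separatingLeft hB'.1 i
  have hs : ∀ i, Real.sqrt |B (g i) (g i)| ≠ 0 := fun i =>
    (Real.sqrt_pos.mpr (abs_pos.mpr (hself i))).ne'
  let f := (g.isUnitSMul (w := fun i => (Real.sqrt |B (g i) (g i)|)⁻¹)
    fun i => (inv_ne_zero (hs i)).isUnit)
  have hff : ∀ i j, B (f i) (f j) = 
      Matrix.diagonal (fun i => (SignType.sign (B (g i) (g i)) : ℝ)) i j := by
    intro i j
    simp only [f, Module.Basis.isUnitSMul_apply, map_smul, LinearMap.smul_apply, smul_eq_mul]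
    by_cases hij : i = j
    · subst hij
      rw [Matrix.diagonal_apply_eq]
      have h1 := Real.mul_self_sqrt (abs_nonneg (B (g i) (g i)))
      have h2 := sign_mul_abs (B (g i) (g i))
      field_simp [hs i]
      rw [pow_two, h1]
      rw [mul_comm]
      exact h2.symm
    · rw [Matrix.diagonal_apply_ne _ hij]
      have : B (g i) (g j) = 0 := hg hij
      simp [this]
  refine ⟨f.reindex (finCongr hn),
    fun i => SignType.sign (B (g (Fin.cast hn.symm i)) (g (Fin.cast hn.symm i))), fun i => ?_,
    fun i j => ?_⟩
  · rcases lt_or_gt_of_ne (hself (Fin.cast hn.symm i)) with h | h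
    · simp [sign_neg h]
    · simp [sign_pos h]
  · simp only [Module.Basis.reindex_apply, hff, finCongr_symm, finCongr_apply]
    simp [Matrix.diagonal_apply]

theorem card_lt_pairs (n : ℕ) : Fintype.card {i : Fin n × Fin n // i.1 < i.2} = n.choose 2 := by
  rw [Nat.choose_two_right, ← Finset.sum_range_id, ← Fin.sum_univ_eq_sum_range (fun i => i),
    Fintype.card_subtype, ← Finset.univ_product_univ, Finset.card_filter,
    Finset.sum_product_right]
  refine Finset.sum_congr rfl fun j _ => ?_
  rw [← Finset.card_filter]
  exact (congrArg Finset.card (by ext; simp)).trans (Fin.card_Iio j)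

/-- Linear combinations of the members of a product basis indexed by a code whose words differ in at
least two coordinates. -/
theorem sum_tprod_mem_variety {n d : ℕ} (hd : 2 ≤ d)
    (B : Fin d → LinearMap.BilinForm ℝ (Fin n → ℝ)) (C : Finset (Fin d → Fin n))
    (hC : ∀ i ∈ C, ∀ j ∈ C, i ≠ j → ∃ k₁ k₂, k₁ ≠ k₂ ∧ i k₁ ≠ j k₁ ∧ i k₂ ≠ j k₂)
    (g : Fin d → Fin n → Fin n → ℝ) (hg : ∀ k p q, p ≠ q → B k (g k p) (g k q) = 0)
    (a : C → ℝ) :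
    ∑ c, a c • PiTensorProduct.tprod ℝ (fun k => g k (c.1 k)) ∈ variety B := by
  refine twoOrthogonalTensors_subset_variety B C.card ?_
  let k₀ : Fin d := ⟨0, by omega⟩
  -- The coefficient is absorbed into one factor, which preserves orthogonality.
  refine ⟨fun i k => (if k = k₀ then a (C.equivFin.symm i) else 1) •
    g k ((C.equivFin.symm i).1 k), fun i j hij => ?_, ?_⟩
  · obtain ⟨k₁, k₂, hk, h₁, h₂⟩ := hC _ (C.equivFin.symm i).2 _ (C.equivFin.symm j).2
      (fun h => hij (C.equivFin.symm.injective (Subtype.ext h)))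
    refine ⟨k₁, k₂, hk, ?_, ?_⟩
    · rw [LinearMap.BilinForm.smul_left, LinearMap.BilinForm.smul_right, hg _ _ _ h₁]; simp
    · rw [LinearMap.BilinForm.smul_left, LinearMap.BilinForm.smul_right, hg _ _ _ h₂]; simp
  · rw [← C.equivFin.symm.sum_comp]
    refine Finset.sum_congr rfl fun i _ => ?_
    rw [MultilinearMap.map_smul_univ]
    simp

end TwoOrthogonal

open TwoOrthogonal in
theorem theorem1p3 (n d : ℕ) (hn : 2 ≤ n) (hd : 2 ≤ d)
    (B : Fin d → LinearMap.BilinForm ℝ (Fin n → ℝ))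
    (hsymm : ∀ k, (B k).IsSymm) (hnondeg : ∀ k, (B k).Nondegenerate) :
    ((n ^ (d - 1) + d * n.choose 2 : ℕ) : WithBot ℕ∞) ≤
      TwoOrthogonal.dimension (TwoOrthogonal.variety B) := by
  have : NeZero n := ⟨by omega⟩
  choose f e he hf using fun k => exists_orthonormal_basis (B k) (hsymm k) (hnondeg k)
  have he0 : ∀ k p, e k p ≠ 0 := fun k p => by rcases he k p with h | h <;> simp [h]
  have heinv : ∀ k p, (e k p)⁻¹ = e k p := fun k p => by rcases he k p with h | h <;> simp [h]
  choose γ hγ0 hγ hγ' using fun k => exists_isometry_parametrization (e k) (he0 k)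
  obtain ⟨A, hA⟩ := exists_weights hd e he
  let I := {i : Fin n × Fin n // i.1 < i.2}
  let C := sumZeroCode n d
  let P := (Fin d × I) ⊕ C
  have hcard : n ^ (d - 1) + d * n.choose 2 = Fintype.card P := by
    obtain ⟨d, rfl⟩ : ∃ d', d = d' + 1 := ⟨d - 1, by omega⟩
    simp only [P, I, C, Fintype.card_sum, Fintype.card_prod, Fintype.card_fin, Fintype.card_coe,
      card_sumZeroCode, card_lt_pairs]
    simp [add_comm]
  let ρ : Fin d → (P → ℝ) →L[ℝ] (I → ℝ) := fun k =>
    ContinuousLinearMap.pi fun i => ContinuousLinearMap.proj (Sum.inl (k, i))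
  let g : (P → ℝ) → Fin d → Fin n → Fin n → ℝ := fun v k q => ∑ p, γ k (ρ k v) p q • f k p
  let Φ : (P → ℝ) → TensorSpace n d := fun v =>
    ∑ c : C, v (Sum.inr c) • PiTensorProduct.tprod ℝ fun k => g v k (c.1 k)
  let b := Basis.piTensorProduct f
  have hΦ : ∀ v, Φ v ∈ variety B := by
    intro v
    refine sum_tprod_mem_variety hd B C (fun i hi j hj => exists_ne_ne_of_mem_sumZeroCode hi hj)
      (g v) (fun k p q hpq => ?_) fun c => v (Sum.inr c)
    have h1 := congrFun (congrFun (hγ k (ρ k v)) p) q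
    rw [Matrix.diagonal_apply_ne _ hpq, Matrix.mul_assoc, Matrix.mul_apply] at h1
    rw [← h1]
    simp only [g, map_sum, map_smul, LinearMap.sum_apply, LinearMap.smul_apply, hf, smul_eq_mul,
      Matrix.transpose_apply, Matrix.mul_apply, Finset.mul_sum]
    rw [Finset.sum_comm]
    refine Finset.sum_congr rfl fun x _ => Finset.sum_congr rfl fun y _ => ?_
    ring
  have hcoord : ∀ v j, b.equivFun (Φ v) j =
      ∑ c : C, v (Sum.inr c) * ∏ k, γ k (ρ k v) (j k) (c.1 k) := by
    intro v j
    simp only [Φ, map_sum, map_smul, Finset.sum_apply, Pi.smul_apply, smul_eq_mul,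
      Module.Basis.equivFun_apply, b, Basis.piTensorProduct_repr_tprod_apply]
    refine Finset.sum_congr rfl fun c _ => ?_
    congr 1
    refine Finset.prod_congr rfl fun k _ => ?_
    simp [g, Finsupp.single_apply]
  -- The base point: identity isometries and the coefficients `A`.
  let v₀ : P → ℝ := Sum.elim 0 fun c => A c.1
  have hρ : ∀ k, ρ k v₀ = 0 := fun k => rfl
  let Φ' : (P → ℝ) →L[ℝ] ((Fin d → Fin n) → ℝ) := ContinuousLinearMap.pi fun j =>
    ∑ c : C, (A c.1 • (∑ k, (∏ l ∈ Finset.univ.erase k, if j l = c.1 l then (1 : ℝ) else 0) •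
        (((e k (j k))⁻¹ • skewEntry (j k) (c.1 k)).comp (ρ k))) +
      (∏ k, if j k = c.1 k then (1 : ℝ) else 0) • ContinuousLinearMap.proj (Sum.inr c))
  have hderiv : HasStrictFDerivAt (fun v => b.equivFun (Φ v)) Φ' v₀ := by
    rw [hasStrictFDerivAt_pi']
    intro j
    simp only [hcoord]
    refine HasStrictFDerivAt.fun_sum fun c _ => ?_
    have h1 : ∀ k, HasStrictFDerivAt (fun v => γ k (ρ k v) (j k) (c.1 k))
        (((e k (j k))⁻¹ • skewEntry (j k) (c.1 k)).comp (ρ k)) v₀ := by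
      intro k
      refine HasStrictFDerivAt.comp (g := fun u => γ k u (j k) (c.1 k)) v₀ ?_
        (ρ k).hasStrictFDerivAt
      rw [hρ]
      exact hγ' k _ _
    have h2 := HasStrictFDerivAt.finsetProd (u := Finset.univ) (fun k _ => h1 k)
    have h3 := (ContinuousLinearMap.proj (R := ℝ) (φ := fun _ : P => ℝ)
      (Sum.inr c)).hasStrictFDerivAt (x := v₀)
    have h4 := h3.mul h2
    simp only [hρ, hγ0, Matrix.one_apply] at h4
    exact h4
  have hinj : Function.Injective Φ' := by
    rw [injective_iff_map_eq_zero]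
    intro v hv
    have hv' : ∀ j, (∑ k, A (Function.update j k (j k - ∑ l, j l)) *
        (e k (j k) * skewEntry (j k) (j k - ∑ l, j l) (ρ k v))) +
        ∑ c : C, (if j = c.1 then 1 else 0) * v (Sum.inr c) = 0 := by
      intro j
      have h1 := congrFun hv j
      rw [← sum_sumZeroCode_neighbours A (fun k q => e k (j k) * skewEntry (j k) q (ρ k v)),
        ← Finset.sum_coe_sort, ← Finset.sum_add_distrib]
      refine Eq.trans ?_ h1
      simp only [Φ', ContinuousLinearMap.coe_pi', sum_apply]
      refine Finset.sum_congr rfl fun c _ => ?_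
      have hp : (∏ k, if j k = c.1 k then (1 : ℝ) else 0) = if j = c.1 then 1 else 0 := by
        simp [Finset.prod_ite_zero, funext_iff]
      simp only [hp, heinv, add_apply, smul_apply, sum_apply,
        ContinuousLinearMap.comp_apply, ContinuousLinearMap.proj_apply, smul_eq_mul]
    have hu : (fun k => ρ k v) = 0 := by
      -- Off the code the coefficient directions contribute nothing.
      refine hA _ fun j hj => ?_
      rw [← hv' j, left_eq_add]
      refine Finset.sum_eq_zero fun c _ => ?_
      rw [if_neg, zero_mul]
      rintro rfl
      exact hj (mem_sumZeroCode.mp c.2)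
    funext x
    rcases x with ⟨k, i⟩ | c
    · exact congrFun (congrFun hu k) i
    · have h1 := hv' c.1
      have h2 : ∀ k, ρ k v = 0 := congrFun hu
      simpa [h2, Subtype.ext_iff.symm] using h1
  rw [hcard]
  exact card_le_dimension_of_hasStrictFDerivAt b Φ hΦ Φ' v₀ hderiv hinj
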